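/- An $n$-qubit Pauli setting is a string $s\in\{X,Y,Z\}^n$; measuring it on an $n$-qubit state $\varrho$ means measuring qubit $i$ in the eigenbasis of the Pauli operator $s_i$ for every $i$, and yields the outcome string $a\in\{0,1\}^n$ with probability $\operatorname{Tr}\bigl(\varrho\bigotimes_{i}\tfrac12(\mathbb 1+(-1)^{a_i}s_i)\bigr)$. A set $S$ of settings allows for the reconstruction of all $k$-body marginals if any two $n$-qubit states with the same outcome probabilities in all settings of $S$ have the same reduced state $\varrho_T=\operatorname{Tr}_{[n]\setminus T}(\varrho)$ for every set $T$ of $k$ qubits. Let $\phi_k(n)$ be the minimal cardinality of such a set $S$. Then $$\phi_3(5)=\phi_3(6)=33 .$$ The same value is the optimum of the associated binary program: for $k=3$ and $n\in\{5,6\}$, the minimum of $\sum_c z_c$ over all $z_c\in\{0,1\}$, $c\in\{X,Y,Z\}^n$, subject to $\sum_c z_c e_c\ge 1$ for every set $e$ of $k$ pairs (qubit, Pauli operator) on $k$ different qubits, is $33$, where $e_c=1$ if the setting $c$ measures on each qubit of $e$ the Pauli operator that $e$ prescribes, and $e_c=0$ otherwise. -/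

import Mathlib

open scoped ComplexOrder

/-- The labels of the three single-qubit Pauli operators. -/
inductive Pauli where
  | X
  | Y
  | Z
  deriving DecidableEq

instance : Fintype Pauli where
  elems := {.X, .Y, .Z}
  complete p := by cases p <;> simp

/-- The Pauli matrices, in the computational basis of `ℂ²`. -/
def Pauli.toMatrix : Pauli → Matrix (Fin 2) (Fin 2) ℂ
  | .X => !![0, 1; 1, 0]
  | .Y => !![0, -Complex.I; Complex.I, 0]
  | .Z => !![1, 0; 0, -1]

/-- The projector `(1 + (-1)^b σ) / 2` onto the eigenspace of the Pauli matrix `σ` with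
eigenvalue `(-1)^b`. -/
noncomputable def Pauli.projector (p : Pauli) (b : Fin 2) : Matrix (Fin 2) (Fin 2) ℂ :=
  (1 / 2 : ℂ) • (1 + (-1 : ℂ) ^ (b : ℕ) • p.toMatrix)

/-- Operators on `(ℂ²)^{⊗ n}`, as matrices in the computational basis, which is indexed by
`Fin n → Fin 2`. -/
abbrev QubitOperator (n : ℕ) : Type :=
  Matrix (Fin n → Fin 2) (Fin n → Fin 2) ℂ

/-- The tensor product of `n` single-qubit operators. -/
def tensorOperator {n : ℕ} (A : Fin n → Matrix (Fin 2) (Fin 2) ℂ) : QubitOperator n :=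
  Matrix.of fun x y => ∏ i, A i (x i) (y i)

/-- Density operators (states) of `n` qubits. -/
def IsState {n : ℕ} (ρ : QubitOperator n) : Prop :=
  ρ.PosSemidef ∧ ρ.trace = 1

/-- An `n`-qubit Pauli setting: each qubit is measured in the eigenbasis of one Pauli operator. -/
abbrev PauliSetting (n : ℕ) : Type := Fin n → Pauli

/-- The Born probability `Tr (ρ ⨂ᵢ Πᵢ)` that measuring the state `ρ` in the Pauli setting `s`
yields the outcome string `a` (qubit `i` gives the eigenvalue `(-1)^(a i)`). -/
noncomputable def outcomeProb {n : ℕ} (ρ : QubitOperator n) (s : PauliSetting n)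
    (a : Fin n → Fin 2) : ℂ :=
  (ρ * tensorOperator fun i => (s i).projector (a i)).trace

/-- The basis string of all `n` qubits that is `x` on the qubits in `T` and `z` on the others. -/
def glue {n : ℕ} (T : Finset (Fin n)) (x : {i // i ∈ T} → Fin 2) (z : {i // i ∉ T} → Fin 2) :
    Fin n → Fin 2 :=
  fun i => if h : i ∈ T then x ⟨i, h⟩ else z ⟨i, h⟩

/-- The marginal of `ρ` on the qubits in `T`: the partial trace over all the other qubits. -/
def marginal {n : ℕ} (ρ : QubitOperator n) (T : Finset (Fin n)) :
    Matrix ({i // i ∈ T} → Fin 2) ({i // i ∈ T} → Fin 2) ℂ :=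
  Matrix.of fun x y => ∑ z : {i // i ∉ T} → Fin 2, ρ (glue T x z) (glue T y z)

/-- A set `S` of Pauli settings allows for the reconstruction of all `k`-body marginals: whenever
two `n`-qubit states have the same outcome statistics in every setting of `S`, they have the same
marginal on every set of `k` qubits. -/
def ReconstructsMarginals (k n : ℕ) (S : Finset (PauliSetting n)) : Prop :=
  ∀ ρ σ : QubitOperator n, IsState ρ → IsState σ →
    (∀ s ∈ S, ∀ a : Fin n → Fin 2, outcomeProb ρ s a = outcomeProb σ s a) →
      ∀ T : Finset (Fin n), T.card = k → marginal ρ T = marginal σ T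

/-- The numbers of settings in the sets of `n`-qubit Pauli settings that allow for the
reconstruction of all `k`-body marginals; its least element is `φ_k(n)`. -/
def pauliSetSizes (k n : ℕ) : Set ℕ :=
  {m | ∃ S : Finset (PauliSetting n), S.card = m ∧ ReconstructsMarginals k n S}

/-- The hyperedges of the `k`-uniform hypergraph `K_{n,3,k}` on the vertices `(i, p)` (qubit `i`,
Pauli operator `p`): the sets of `k` vertices that belong to pairwise different qubits. -/
def IsHyperedge (k n : ℕ) (e : Finset (Fin n × Pauli)) : Prop :=
  e.card = k ∧ Set.InjOn Prod.fst (e : Set (Fin n × Pauli))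

/-- The clique of `K_{n,3,k}` that represents a Pauli setting. -/
def settingClique {n : ℕ} (s : PauliSetting n) : Finset (Fin n × Pauli) :=
  Finset.univ.image fun i => (i, s i)

/-- Feasible points of the binary program: `z_c ∈ {0, 1}` for every Pauli setting `c`, and
`∑_c z_c e_c ≥ 1` for every hyperedge `e`, where `e_c` is `1` if `e` lies in the clique of `c`,
and `0` otherwise. -/
def IsFeasible (k n : ℕ) (z : PauliSetting n → ℕ) : Prop :=
  (∀ c, z c = 0 ∨ z c = 1) ∧
    ∀ e, IsHyperedge k n e → 1 ≤ ∑ c, z c * (if e ⊆ settingClique c then 1 else 0)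

/-- The values of the objective `∑_c z_c` at the feasible points of the binary program. -/
def binaryProgramValues (k n : ℕ) : Set ℕ :=
  {m | ∃ z : PauliSetting n → ℕ, IsFeasible k n z ∧ ∑ c, z c = m}

/-!
For `k > 0`, a set `S` of Pauli settings determines all `k`-body marginals if and only if it is a
covering array of strength `k`: every assignment of Pauli operators to `k` qubits is extended by a setting in `S`
(`Covers`). If so, the expectations of products of eigenprojectors on `k` qubits are sums of outcome
probabilities, and these products span the operators on the `k` qubits
(`Covers.reconstructsMarginals`). If the operators `p` on `T` are extended by no setting in `S`, the
states `1 / 2 ^ n` and `(1 + P) / 2 ^ n`, where `P` is the product of the operators `p` on `T`, have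
the same outcome probabilities and different marginals on `T` (`ReconstructsMarginals.covers`). The
binary program, too, asks for the least size of a covering array (`binaryProgramValues_eq`).

It remains to see that a covering array of strength three with three symbols and five or six columns
has at least `33` rows, and that `33` suffice. Dropping a column keeps the covering property, so the
lower bound is needed for five columns and the construction for six.

For the construction, take all the words that arise by permuting the symbols of the constant word
and of five other words; it is enough that on any three columns these five show every pattern of
equal and distinct symbols other than the constant one (`covers_starterSettings`).

For the lower bound, an array with at most `32` rows has in each column a symbol that occurs at most
ten times. Calling these symbols `0` gives a tight array (`IsTight`), and there are no tight arrays
(`IsTight.false`). Indeed, the at most ten words that are `0` in a column `i` show all nine pairs of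
symbols in any two further columns `b`, `c`, so at most one pair of them agrees there: once two
chosen words collide in this way, no further word that is `0` in column `i` can repeat the symbols
that a chosen word shows in `i`, `b`, `c`. This constraint is strong enough for a short exhaustive
search, which branches on the words that cover a given triple of symbols. By permuting columns and
the symbols `1` and `2`, one of the words with the most zeros, `00000` aside, becomes `00001`, `00011` or `00111`,
which leaves seven searches; the kernel carries them out (`TightSearch.refutes`), and
`TightSearch.not_refutes` shows that the search is sound.
-/

/-! ### A search for tight covering arrays -/

namespace TightSearch

/-- `strict n f = f n`, arranged so that the kernel evaluates `n` to a numeral before it enters `f`.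
The low 64 bits of the numeral that the kernel substitutes are a remainder of `n`: it hashes a
numeral by these bits, and sets of words, taken as they are, would often agree on them. -/
def strict {α : Type} (n : ℕ) (f : ℕ → α) : α :=
  match Nat.add (Nat.shiftLeft n 64) (Nat.mod n 18446744073709551557) with
  | 0 => f n
  | k + 1 => f (Nat.shiftRight (Nat.succ k) 64)

/-- The ternary digit `i` of `x`. The code `x < 243` stands for the word of its five digits. -/
def digit (x i : ℕ) : ℕ := Nat.mod (Nat.div x (Nat.pow 3 i)) 3

/-- The number of zeros among the five digits of `x`. -/
def zeros (x : ℕ) : ℕ :=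
  (List.range 5).foldr (fun i n => bif Nat.beq (digit x i) 0 then n + 1 else n) 0

/-- A set of codes is a number whose bit `5 * x` says whether `x` is a member. The four bits in
between leave room for adding up such numbers. -/
def mem (s x : ℕ) : Bool := Nat.beq (Nat.land (Nat.shiftRight s (Nat.mul 5 x)) 1) 1

/-- The difference of two sets. -/
def diff (s t : ℕ) : ℕ := Nat.xor s (Nat.land s t)

/-- The set of the codes whose digit `i` is `0`: a block of `3 ^ i` members, repeated with period
`3 ^ (i + 1)`. -/
def zeroSet (i : ℕ) : ℕ :=
  Nat.mul (Nat.div (Nat.sub (Nat.pow 2 (Nat.mul 5 (Nat.pow 3 i))) 1) 31)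
    (Nat.div (Nat.sub (Nat.pow 2 1215) 1) (Nat.sub (Nat.pow 2 (Nat.mul 15 (Nat.pow 3 i))) 1))

/-- The set of the codes that agree with `x` in the digit `i`. -/
def agree (x i : ℕ) : ℕ :=
  Nat.shiftLeft (zeroSet i) (Nat.mul 5 (Nat.mul (digit x i) (Nat.pow 3 i)))

/-- The set of the codes that have the digit `i` equal to `0`, if `x` has, and else the empty
set. -/
def zeroAgree (x i : ℕ) : ℕ := bif Nat.beq (digit x i) 0 then zeroSet i else 0

/-- What the search knows about the columns `a`, `b`, `c` (`d` and `e` being the other two), given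
the words chosen so far: `cov` is the set of the words that agree on `a`, `b`, `c` with a chosen
one, and `sat` is the set of the words that are `0` in a column `i` among `a`, `b`, `c` such that
two of the chosen words are `0` in `i` and agree on `a`, `b`, `c`. -/
structure TripleState where
  a : ℕ
  b : ℕ
  c : ℕ
  d : ℕ
  e : ℕ
  cov : ℕ
  sat : ℕ

/-- The state in which no word is chosen. -/
def initial : List TripleState :=
  [⟨0, 1, 2, 3, 4, 0, 0⟩, ⟨0, 1, 3, 2, 4, 0, 0⟩, ⟨0, 1, 4, 2, 3, 0, 0⟩, ⟨0, 2, 3, 1, 4, 0, 0⟩,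
    ⟨0, 2, 4, 1, 3, 0, 0⟩, ⟨0, 3, 4, 1, 2, 0, 0⟩, ⟨1, 2, 3, 0, 4, 0, 0⟩, ⟨1, 2, 4, 0, 3, 0, 0⟩,
    ⟨1, 3, 4, 0, 2, 0, 0⟩, ⟨2, 3, 4, 0, 1, 0, 0⟩]

/-- Chooses the word `x`, and passes on the new state and the set of the words that cannot be chosen
any more. -/
def advance (x : ℕ) : List TripleState → (List TripleState → ℕ → Bool) → Bool
  | [], k => k [] 0
  | ⟨a, b, c, d, e, cov, sat⟩ :: l, k =>
    strict (Nat.lor cov (Nat.land (agree x a) (Nat.land (agree x b) (agree x c)))) fun cov' =>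
    strict (bif mem cov x then
        Nat.lor sat (Nat.lor (zeroAgree x a) (Nat.lor (zeroAgree x b) (zeroAgree x c)))
      else sat) fun sat' =>
    advance x l fun l' f =>
      k (⟨a, b, c, d, e, cov', sat'⟩ :: l') (Nat.lor f (Nat.land cov' sat'))

/-! The functions up to `pick` choose the cell (three columns and their symbols) to branch on: an
uncovered one that contains a zero and has the fewest candidates. Nothing has to be proved about
that choice. -/

/-- Sums the counts in `m` over the three digits at place `i`. The sums stand at the words with the
digit `0` there. -/
def sum3 (m i : ℕ) : ℕ :=
  Nat.add m (Nat.add (Nat.shiftRight m (Nat.mul 5 (Nat.pow 3 i)))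
    (Nat.shiftRight m (Nat.mul 10 (Nat.pow 3 i))))

/-- The words that stand for the cells of the columns `a`, `b`, `c` that contain a zero: they are `0`
in the other columns. -/
def cells (a b c d e : ℕ) : ℕ :=
  Nat.land (Nat.land (zeroSet d) (zeroSet e))
    (Nat.lor (zeroSet a) (Nat.lor (zeroSet b) (zeroSet c)))

/-- The uncovered cells of all the triples of columns, in consecutive blocks of `1215 = 5 * 243`
bits. -/
def uncovered : List TripleState → ℕ
  | [] => 0
  | ⟨a, b, c, d, e, cov, _⟩ :: l =>
    Nat.lor (strict (cells a b c d e) fun n => diff n cov) (Nat.shiftLeft (uncovered l) 1215)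

/-- The numbers of candidates in the cells, as digits to the base `32`. -/
def counts (m : ℕ) : List TripleState → ℕ
  | [] => 0
  | t :: l =>
    Nat.lor (strict (sum3 m t.d) fun n => sum3 n t.e) (Nat.shiftLeft (counts m l) 1215)

/-- The number with all its `2430` digits to the base `32` equal to `1`. -/
def ones : ℕ := Nat.div (Nat.sub (Nat.pow 2 12150) 1) 31

/-- `topBit j n p` is `p` plus the position of the leading bit of `n < 2 ^ 2 ^ j`. -/
def topBit : ℕ → ℕ → ℕ → ℕ
  | 0, _, p => p
  | j + 1, n, p =>
    bif Nat.ble (Nat.pow 2 (Nat.pow 2 j)) n then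
      strict (Nat.shiftRight n (Nat.pow 2 j)) fun n => topBit j n (Nat.add p (Nat.pow 2 j))
    else topBit j n p

/-- A position in `u` whose count in `t` is least. The counts of at least `16 - n` are those that
reach `16` when `n` is added. -/
def least (u t : ℕ) : ℕ → ℕ
  | 0 => 0
  | n + 1 =>
    strict (Nat.land u (Nat.shiftRight (Nat.add t (Nat.mul n ones)) 4)) fun v =>
      bif Nat.beq v u then least u t n
      else strict (Nat.xor u v) fun w => Nat.div (topBit 14 w 0) 5

/-- The cell to branch on: `243` times the index of the triple of columns plus the word of the
cell. -/
def pick (l : List TripleState) (m : ℕ) : ℕ :=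
  strict (uncovered l) fun u => strict (counts m l) fun t => least u t 16

/-- Checks `f x m'` for every member `x` of `h`, where `m'` is the set `m` without `x` and the members
tried before. -/
def branch (f : ℕ → ℕ → Bool) : ℕ → ℕ → ℕ → Bool
  | 0, h, _ => Nat.beq h 0
  | n + 1, h, m =>
    bif Nat.beq h 0 then true else
      strict (Nat.div (topBit 11 h 0) 5) fun x =>
      strict (Nat.pow 2 (Nat.mul 5 x)) fun b =>
      strict (diff m b) fun m' =>
        (mem h x && f x m') && strict (diff h b) fun h' => branch f n h' m'

/-- Whether the words chosen so far, with state `l`, are refuted as part of a tight array, by a search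
of depth less than `n`, if all further words are from the set `m`. At most `9` words of five symbols
contain a given cell of three. -/
def search : ℕ → List TripleState → ℕ → Bool
  | 0, _, _ => false
  | n + 1, l, m =>
    strict (pick l m) fun p =>
    match l.drop (Nat.div p 243) with
    | [] => false
    | t :: _ =>
      strict (Nat.mod p 243) fun y =>
      !(mem t.cov y) &&
        strict (Nat.land m (Nat.land (agree y t.a) (Nat.land (agree y t.b) (agree y t.c)))) fun h =>
        branch (fun x m' => advance x l fun l' f => strict (diff m' f) fun m'' => search n l' m'')
          9 h m

/-- The search after the words in a list have been chosen. The depth `30` is never reached. -/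
def searchFrom : List ℕ → List TripleState → ℕ → Bool
  | [], l, m => search 30 l m
  | x :: xs, l, m => advance x l fun l' f => strict (diff m f) fun m' => searchFrom xs l' m'

/-- The set of the words with at most `k` zeros. -/
def atMost (k : ℕ) : ℕ :=
  (List.range 243).foldr
    (fun x w => bif Nat.ble (zeros x) k then Nat.lor (Nat.pow 2 (Nat.mul 5 x)) w else w) 0

/-- Whether the search shows that no tight array consists of the words in `xs` and of words with at
most `k` zeros. -/
def refutes (xs : List ℕ) (k : ℕ) : Bool :=
  strict (diff (atMost k) (xs.foldr (fun x w => Nat.lor (Nat.pow 2 (Nat.mul 5 x)) w) 0)) fun m =>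
    searchFrom xs initial m

/-! ### Soundness of the search -/

theorem strict_eq {α : Type} (n : ℕ) (f : ℕ → α) : strict n f = f n := by
  have h : (n <<< 64 + n % 18446744073709551557) >>> 64 = n := by
    rw [Nat.shiftLeft_eq, Nat.shiftRight_eq_div_pow]
    have := Nat.mod_lt n (show 18446744073709551557 > 0 by norm_num)
    omega
  unfold strict
  split
  · rfl
  · next k hk =>
    have : Nat.succ k = n <<< 64 + n % 18446744073709551557 := hk.symm
    rw [this]
    exact congrArg f h

theorem mem_eq (s x : ℕ) : mem s x = s.testBit (5 * x) := by
  have h : Nat.land (Nat.shiftRight s (Nat.mul 5 x)) 1 = (s >>> (5 * x)) % 2 := Nat.and_one_is_mod _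
  rw [mem, h, Nat.testBit_eq_decide_div_mod_eq, Nat.shiftRight_eq_div_pow, Bool.eq_iff_iff,
    Nat.beq_eq, decide_eq_true_iff]

theorem mem_lor (s t x : ℕ) : mem (Nat.lor s t) x = (mem s x || mem t x) := by
  simp only [mem_eq]
  exact Nat.testBit_or s t _

theorem mem_land (s t x : ℕ) : mem (Nat.land s t) x = (mem s x && mem t x) := by
  simp only [mem_eq]
  exact Nat.testBit_and s t _

theorem mem_diff (s t x : ℕ) : mem (diff s t) x = (mem s x && !mem t x) := by
  have h : mem (diff s t) x = (mem s x ^^ mem (Nat.land s t) x) := by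
    simp only [mem_eq]
    exact Nat.testBit_xor s _ _
  rw [h, mem_land]
  cases mem s x <;> cases mem t x <;> rfl

theorem mem_zero (x : ℕ) : mem 0 x = false := by simp [mem_eq]

theorem mem_two_pow (x y : ℕ) : mem (Nat.pow 2 (Nat.mul 5 x)) y = decide (x = y) := by
  rw [mem_eq]
  exact (Nat.testBit_two_pow (n := 5 * x) (m := 5 * y)).trans (by congr 1; simp)

theorem digit_lt (x i : ℕ) : digit x i < 3 := Nat.mod_lt _ (by norm_num)

theorem mem_digitSet : ∀ i < 5, ∀ v < 3, ∀ y < 243,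
    mem (Nat.shiftLeft (zeroSet i) (Nat.mul 5 (Nat.mul v (Nat.pow 3 i)))) y =
      Nat.beq (digit y i) v := by
  decide +kernel

theorem mem_agree {x i y : ℕ} (hi : i < 5) (hy : y < 243) :
    mem (agree x i) y = true ↔ digit y i = digit x i := by
  rw [agree, mem_digitSet i hi _ (digit_lt x i) y hy, Nat.beq_eq]

theorem mem_zeroAgree {x i y : ℕ} (hi : i < 5) (hy : y < 243) :
    mem (zeroAgree x i) y = true ↔ digit x i = 0 ∧ digit y i = 0 := by
  have h := mem_digitSet i hi 0 (by norm_num) y hy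
  have h0 : Nat.shiftLeft (zeroSet i) (Nat.mul 5 (Nat.mul 0 (Nat.pow 3 i))) = zeroSet i := by simp
  rw [h0] at h
  by_cases hx : digit x i = 0
  · have : zeroAgree x i = zeroSet i := by simp [zeroAgree, hx]
    rw [this, h, Nat.beq_eq]
    simp [hx]
  · have : zeroAgree x i = 0 := by
      rw [← Nat.beq_eq, Bool.not_eq_true] at hx
      rw [zeroAgree, hx, cond_false]
    rw [this, mem_zero]
    simp [hx]

theorem mem_foldr (p : ℕ → Bool) (l : List ℕ) (y : ℕ) :
    mem (l.foldr (fun x w => bif p x then Nat.lor (Nat.pow 2 (Nat.mul 5 x)) w else w) 0) y = true ↔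
      y ∈ l ∧ p y = true := by
  induction l with
  | nil => simp [mem_zero]
  | cons x l ih =>
    rw [List.foldr_cons, List.mem_cons]
    cases hp : p x
    · rw [cond_false, ih]
      constructor
      · exact fun h => ⟨.inr h.1, h.2⟩
      · rintro ⟨rfl | h, h'⟩
        · simp [hp] at h'
        · exact ⟨h, h'⟩
    · rw [cond_true, mem_lor, mem_two_pow, Bool.or_eq_true, ih, decide_eq_true_iff]
      constructor
      · rintro (rfl | h)
        · exact ⟨.inl rfl, hp⟩
        · exact ⟨.inr h.1, h.2⟩
      · rintro ⟨rfl | h, h'⟩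
        · exact .inl rfl
        · exact .inr ⟨h, h'⟩

/-- The codes `x` and `y` agree in the digits `a`, `b`, `c`. -/
def Agree (a b c x y : ℕ) : Prop :=
  digit x a = digit y a ∧ digit x b = digit y b ∧ digit x c = digit y c

theorem Agree.symm {a b c x y : ℕ} (h : Agree a b c x y) : Agree a b c y x :=
  ⟨h.1.symm, h.2.1.symm, h.2.2.symm⟩

theorem mem_agree_agree {a b c x y : ℕ} (ha : a < 5) (hb : b < 5) (hc : c < 5) (hy : y < 243) :
    mem (Nat.land (agree x a) (Nat.land (agree x b) (agree x c))) y = true ↔ Agree a b c y x := by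
  simp only [mem_land, Bool.and_eq_true, mem_agree ha hy, mem_agree hb hy, mem_agree hc hy, Agree]

/-- What the search uses about a tight array, given by the set of the codes of its words. -/
structure IsTightCode (C : Set ℕ) : Prop where
  lt : ∀ x ∈ C, x < 243
  covers : ∀ a b c, a < b → b < c → c < 5 → ∀ y < 243, ∃ x ∈ C, Agree a b c x y
  collide : ∀ a b c, a < b → b < c → c < 5 → ∀ i, i = a ∨ i = b ∨ i = c →
    ∀ u ∈ C, ∀ v ∈ C, ∀ w ∈ C, ∀ z ∈ C, u ≠ v → w ≠ z → digit u i = 0 → digit w i = 0 →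
      Agree a b c u v → Agree a b c w z → w = u ∨ w = v

/-- The state of a triple of columns describes the chosen words `L`. -/
structure Describes (L : List ℕ) (t : TripleState) : Prop where
  hab : t.a < t.b
  hbc : t.b < t.c
  hc : t.c < 5
  cov : ∀ y < 243, mem t.cov y = true ↔ ∃ x ∈ L, Agree t.a t.b t.c x y
  sat : ∀ y < 243, mem t.sat y = true → ∃ i, (i = t.a ∨ i = t.b ∨ i = t.c) ∧ digit y i = 0 ∧
    ∃ u ∈ L, ∃ v ∈ L, u ≠ v ∧ digit u i = 0 ∧ Agree t.a t.b t.c u v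

/-- The effect of choosing the word `x` on the state of a triple of columns. -/
def step (x : ℕ) (t : TripleState) : TripleState :=
  { t with
    cov := Nat.lor t.cov (Nat.land (agree x t.a) (Nat.land (agree x t.b) (agree x t.c)))
    sat := bif mem t.cov x then
        Nat.lor t.sat (Nat.lor (zeroAgree x t.a) (Nat.lor (zeroAgree x t.b) (zeroAgree x t.c)))
      else t.sat }

/-- The words that would collide for a second time with a zero in the same column. -/
def forbidden (l : List TripleState) : ℕ :=
  l.foldr (fun t f => Nat.lor f (Nat.land t.cov t.sat)) 0

theorem advance_eq (x : ℕ) (l : List TripleState) (k : List TripleState → ℕ → Bool) :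
    advance x l k = k (l.map (step x)) (forbidden (l.map (step x))) := by
  induction l generalizing k with
  | nil => rfl
  | cons t l ih =>
    obtain ⟨a, b, c, d, e, cov, sat⟩ := t
    rw [advance, strict_eq, strict_eq, ih]
    rfl

theorem mem_forbidden {l : List TripleState} {y : ℕ} (h : mem (forbidden l) y = true) :
    ∃ t ∈ l, mem t.cov y = true ∧ mem t.sat y = true := by
  induction l with
  | nil => simp [forbidden, mem_zero] at h
  | cons t l ih =>
    rw [forbidden, List.foldr_cons, mem_lor, mem_land, Bool.or_eq_true, Bool.and_eq_true] at h
    obtain h | h := h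
    · obtain ⟨t', ht', h'⟩ := ih h
      exact ⟨t', List.mem_cons_of_mem _ ht', h'⟩
    · exact ⟨t, List.mem_cons_self, h⟩

theorem Describes.step {L : List ℕ} {t : TripleState} (h : Describes L t) {x : ℕ} (hx : x < 243)
    (hL : x ∉ L) : Describes (x :: L) (step x t) := by
  have hb : t.b < 5 := h.hbc.trans h.hc
  have ha : t.a < 5 := h.hab.trans hb
  refine ⟨h.hab, h.hbc, h.hc, fun y hy => ?_, fun y hy hm => ?_⟩
  · change mem (Nat.lor t.cov _) y = true ↔ ∃ z ∈ x :: L, Agree t.a t.b t.c z y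
    rw [mem_lor, Bool.or_eq_true, h.cov y hy, mem_agree_agree ha hb h.hc hy]
    simp only [List.mem_cons, exists_eq_or_imp]
    exact ⟨fun h => h.elim .inr fun h => .inl h.symm, fun h => h.elim (fun h => .inr h.symm) .inl⟩
  · change ∃ i, (i = t.a ∨ i = t.b ∨ i = t.c) ∧ digit y i = 0 ∧
      ∃ u ∈ x :: L, ∃ v ∈ x :: L, u ≠ v ∧ digit u i = 0 ∧ Agree t.a t.b t.c u v
    have old (hm : mem t.sat y = true) : ∃ i, (i = t.a ∨ i = t.b ∨ i = t.c) ∧ digit y i = 0 ∧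
        ∃ u ∈ x :: L, ∃ v ∈ x :: L, u ≠ v ∧ digit u i = 0 ∧ Agree t.a t.b t.c u v := by
      obtain ⟨i, hi, hyi, u, hu, v, hv, h'⟩ := h.sat y hy hm
      exact ⟨i, hi, hyi, u, .tail _ hu, v, .tail _ hv, h'⟩
    change mem (bif mem t.cov x then _ else _) y = true at hm
    by_cases hcov : mem t.cov x = true
    · obtain ⟨z, hz, hzx⟩ := (h.cov x hx).1 hcov
      have new (i : ℕ) (hi : i = t.a ∨ i = t.b ∨ i = t.c) (h' : digit x i = 0 ∧ digit y i = 0) :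
          ∃ i, (i = t.a ∨ i = t.b ∨ i = t.c) ∧ digit y i = 0 ∧
            ∃ u ∈ x :: L, ∃ v ∈ x :: L, u ≠ v ∧ digit u i = 0 ∧ Agree t.a t.b t.c u v :=
        ⟨i, hi, h'.2, x, .head _, z, .tail _ hz, fun e => hL (e ▸ hz), h'.1, hzx.symm⟩
      rw [hcov, cond_true] at hm
      simp only [mem_lor, Bool.or_eq_true, mem_zeroAgree ha hy, mem_zeroAgree hb hy,
        mem_zeroAgree h.hc hy] at hm
      obtain hm | hm | hm | hm := hm
      · exact old hm
      · exact new t.a (.inl rfl) hm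
      · exact new t.b (.inr (.inl rfl)) hm
      · exact new t.c (.inr (.inr rfl)) hm
    · rw [Bool.not_eq_true] at hcov
      rw [hcov, cond_false] at hm
      exact old hm

/-- In a tight array, there is room for one collision in the words that are `0` in a given column, so
a saturated cell that is covered cannot be hit again. -/
theorem IsTightCode.not_mem_forbidden {C : Set ℕ} (hC : IsTightCode C) {L : List ℕ}
    (hLC : ∀ x ∈ L, x ∈ C) {l : List TripleState} (hl : ∀ t ∈ l, Describes L t) {y : ℕ} (hy : y ∈ C)
    (hyL : y ∉ L) : mem (forbidden l) y = false := by
  rw [← Bool.not_eq_true]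
  intro h
  obtain ⟨t, ht, hcov, hsat⟩ := mem_forbidden h
  have hd := hl t ht
  have hy' := hC.lt y hy
  obtain ⟨x, hx, hxy⟩ := (hd.cov y hy').1 hcov
  obtain ⟨i, hi, hyi, u, hu, v, hv, huv, hui, hag⟩ := hd.sat y hy' hsat
  obtain rfl | rfl := hC.collide t.a t.b t.c hd.hab hd.hbc hd.hc i hi u (hLC u hu) v (hLC v hv) y hy
    x (hLC x hx) huv (fun e => hyL (e ▸ hx)) hui hyi hag hxy.symm
  · exact hyL hu
  · exact hyL hv

theorem exists_of_branch {f : ℕ → ℕ → Bool} (C : Set ℕ) {n h m : ℕ} (hb : branch f n h m = true)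
    {c : ℕ} (hc : c ∈ C) (hch : mem h c = true) :
    ∃ x ∈ C, mem h x = true ∧ ∃ m', f x m' = true ∧
      ∀ z ∈ C, z ≠ x → mem m z = true → mem m' z = true := by
  induction n generalizing h m with
  | zero =>
    have : h = 0 := Nat.eq_of_beq_eq_true hb
    simp [this, mem_zero] at hch
  | succ n ih =>
    have h0 : Nat.beq h 0 = false := by
      rw [← Bool.not_eq_true, Nat.beq_eq]
      rintro rfl
      simp [mem_zero] at hch
    rw [branch, h0, cond_false, strict_eq, strict_eq, strict_eq, strict_eq] at hb
    generalize Nat.div (topBit 11 h 0) 5 = x at hb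
    simp only [Bool.and_eq_true] at hb
    obtain ⟨⟨hx, hf⟩, hb⟩ := hb
    have hm (z : ℕ) (hz : z ≠ x) (s : ℕ) :
        mem (diff s (Nat.pow 2 (Nat.mul 5 x))) z = mem s z := by
      rw [mem_diff, mem_two_pow]
      simp [hz.symm]
    by_cases hxC : x ∈ C
    · exact ⟨x, hxC, hx, _, hf, fun z _ hz hmz => by rwa [hm z hz]⟩
    · have ne (z : ℕ) (hz : z ∈ C) : z ≠ x := fun e => hxC (e ▸ hz)
      obtain ⟨x', hx', hhx', m', hf', hm'⟩ := ih hb (by rwa [hm c (ne c hc)])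
      refine ⟨x', hx', by rwa [hm x' (ne x' hx')] at hhx', m', hf', fun z hz hzx hmz => ?_⟩
      exact hm' z hz hzx (by rwa [hm z (ne z hz)])

theorem not_search {C : Set ℕ} (hC : IsTightCode C) {n : ℕ} {l : List TripleState} {m : ℕ}
    {L : List ℕ} (hLC : ∀ x ∈ L, x ∈ C) (hl : ∀ t ∈ l, Describes L t)
    (hm : ∀ x ∈ C, x ∉ L → mem m x = true) : search n l m ≠ true := by
  induction n generalizing l m L with
  | zero => simp [search]
  | succ n ih =>
    intro h
    rw [search, strict_eq] at h
    generalize pick l m = p at h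
    split at h
    · exact Bool.false_ne_true h
    next t l' ht =>
    have hd : Describes L t := hl t (List.mem_of_mem_drop (ht ▸ List.mem_cons_self))
    rw [strict_eq, strict_eq, Bool.and_eq_true] at h
    have hy : Nat.mod p 243 < 243 := Nat.mod_lt _ (by norm_num)
    generalize Nat.mod p 243 = y at h hy
    obtain ⟨hcov, h⟩ := h
    have hb : t.b < 5 := hd.hbc.trans hd.hc
    have ha : t.a < 5 := hd.hab.trans hb
    have hcov : ¬ ∃ x ∈ L, Agree t.a t.b t.c x y := by
      rw [← hd.cov y hy]
      simpa using hcov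
    obtain ⟨c, hc, hcy⟩ := hC.covers t.a t.b t.c hd.hab hd.hbc hd.hc y hy
    have hcL : c ∉ L := fun hL => hcov ⟨c, hL, hcy⟩
    obtain ⟨x, hx, hhx, m', hf, hm'⟩ := exists_of_branch C h hc (by
      rw [mem_land, hm c hc hcL, (mem_agree_agree ha hb hd.hc (hC.lt c hc)).2 hcy]; rfl)
    rw [mem_land, Bool.and_eq_true, mem_agree_agree ha hb hd.hc (hC.lt x hx)] at hhx
    have hxL : x ∉ L := fun hL => hcov ⟨x, hL, hhx.2⟩
    rw [advance_eq, strict_eq] at hf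
    have hLC' : ∀ z ∈ x :: L, z ∈ C := by
      rintro z (_ | ⟨_, hz⟩)
      exacts [hx, hLC z hz]
    have hl' : ∀ t ∈ l.map (step x), Describes (x :: L) t := by
      intro t ht
      obtain ⟨t', ht', rfl⟩ := List.mem_map.1 ht
      exact (hl t' ht').step (hC.lt x hx) hxL
    refine ih hLC' hl' (fun z hz hzL => ?_) hf
    rw [List.mem_cons, not_or] at hzL
    rw [mem_diff, hm' z hz hzL.1 (hm z hz hzL.2),
      hC.not_mem_forbidden hLC' hl' hz (by simpa using hzL)]
    rfl

theorem not_searchFrom {C : Set ℕ} (hC : IsTightCode C) {xs : List ℕ} {l : List TripleState} {m : ℕ}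
    {L : List ℕ} (hLC : ∀ x ∈ L, x ∈ C) (hl : ∀ t ∈ l, Describes L t) (hxs : ∀ x ∈ xs, x ∈ C)
    (hnd : (xs ++ L).Nodup) (hm : ∀ x ∈ C, x ∉ xs ++ L → mem m x = true) :
    searchFrom xs l m ≠ true := by
  induction xs generalizing l m L with
  | nil => exact not_search hC hLC hl hm
  | cons x xs ih =>
    rw [searchFrom, advance_eq, strict_eq]
    have hx := hxs x List.mem_cons_self
    rw [List.cons_append, List.nodup_cons, List.mem_append, not_or] at hnd
    have hLC' : ∀ z ∈ x :: L, z ∈ C := by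
      rintro z (_ | ⟨_, hz⟩)
      exacts [hx, hLC z hz]
    have hl' : ∀ t ∈ l.map (step x), Describes (x :: L) t := by
      intro t ht
      obtain ⟨t', ht', rfl⟩ := List.mem_map.1 ht
      exact (hl t' ht').step (hC.lt x hx) hnd.1.2
    have hp : (xs ++ x :: L).Perm (x :: (xs ++ L)) := List.perm_middle
    refine ih hLC' hl' (fun z hz => hxs z (.tail _ hz)) ?_ fun z hz hzn => ?_
    · rw [hp.nodup_iff, List.nodup_cons, List.mem_append, not_or]
      exact hnd
    · rw [mem_diff, hm z hz (by rwa [List.cons_append, ← hp.mem_iff]),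
        hC.not_mem_forbidden hLC' hl' hz fun h => hzn (List.mem_append_right _ h)]
      rfl

theorem not_refutes {C : Set ℕ} (hC : IsTightCode C) {xs : List ℕ} {k : ℕ} (hxs : ∀ x ∈ xs, x ∈ C)
    (hnd : xs.Nodup) (hk : ∀ x ∈ C, x ∉ xs → zeros x ≤ k) : refutes xs k ≠ true := by
  rw [refutes, strict_eq]
  refine not_searchFrom hC (L := []) (by simp) ?_ hxs (by simpa using hnd) fun x hx hxn => ?_
  · intro t ht
    have : t.a < t.b ∧ t.b < t.c ∧ t.c < 5 ∧ t.cov = 0 ∧ t.sat = 0 := by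
      simp only [initial, List.mem_cons, List.not_mem_nil, or_false] at ht
      rcases ht with rfl | rfl | rfl | rfl | rfl | rfl | rfl | rfl | rfl | rfl <;> decide
    obtain ⟨h1, h2, h3, h4, h5⟩ := this
    exact ⟨h1, h2, h3, fun y _ => by simp [h4, mem_zero], fun y _ => by simp [h5, mem_zero]⟩
  · rw [List.append_nil] at hxn
    have h1 : mem (atMost k) x = true := by
      rw [atMost, mem_foldr]
      exact ⟨List.mem_range.2 (hC.lt x hx), Nat.ble_eq_true_of_le (hk x hx hxn)⟩
    have h2 := mem_foldr (fun _ => true) xs x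
    simp only [cond_true, and_true] at h2
    rw [mem_diff, h1, Bool.true_and, Bool.not_eq_true', ← Bool.not_eq_true, h2]
    exact hxn

end TightSearch

/-! ### Tight arrays -/

/-- A row of an array with five columns and three symbols. -/
abbrev Word := Fin 5 → Fin 3

/-- An array of strength three (every three columns show every three symbols) such that the symbol
`0` occurs at most ten times in each column. -/
structure IsTight (C : Finset Word) : Prop where
  covers : ∀ a b c, a ≠ b → a ≠ c → b ≠ c → ∀ w : Word, ∃ r ∈ C, r a = w a ∧ r b = w b ∧ r c = w c
  card_le : ∀ a, (C.filter fun r => r a = 0).card ≤ 10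

namespace Word

/-- The number with the ternary digits `r 0`, …, `r 4`, the digit `r 0` being the lowest. -/
def code (r : Word) : ℕ := r 0 + 3 * r 1 + 9 * r 2 + 27 * r 3 + 81 * r 4

def numZeros (r : Word) : ℕ := (Finset.univ.filter fun i => r i = 0).card

theorem code_lt (r : Word) : r.code < 243 := by unfold code; omega

theorem digit_code (r : Word) : ∀ i : Fin 5, TightSearch.digit r.code i = r i := by
  have h0 := (r 0).isLt
  have h1 := (r 1).isLt
  have h2 := (r 2).isLt
  have h3 := (r 3).isLt
  have h4 := (r 4).isLt
  intro i
  change r.code / 3 ^ (i : ℕ) % 3 = r i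
  unfold code
  fin_cases i <;> simp <;> omega

theorem code_injective : Function.Injective code := fun r s h => funext fun i => Fin.ext <| by
  rw [← digit_code, ← digit_code, h]

theorem exists_code_eq {x : ℕ} (hx : x < 243) : ∃ r : Word, r.code = x := by
  refine ⟨fun i => ⟨x / 3 ^ (i : ℕ) % 3, Nat.mod_lt _ (by norm_num)⟩, ?_⟩
  simp [code]
  omega

theorem zeros_code (r : Word) : TightSearch.zeros r.code = r.numZeros := by
  have h (i : Fin 5) : Nat.beq (TightSearch.digit r.code i) 0 = decide (r i = 0) := by
    rw [Bool.eq_iff_iff, Nat.beq_eq, digit_code, decide_eq_true_iff, Fin.ext_iff]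
    rfl
  have h0 := h 0
  have h1 := h 1
  have h2 := h 2
  have h3 := h 3
  have h4 := h 4
  have hr : List.range 5 = [(0 : Fin 5).val, (1 : Fin 5).val, (2 : Fin 5).val, (3 : Fin 5).val,
    (4 : Fin 5).val] := rfl
  rw [numZeros, Finset.card_filter, Fin.sum_univ_five, TightSearch.zeros, hr]
  simp only [List.foldr_cons, List.foldr_nil, h0, h1, h2, h3, h4]
  split_ifs <;> simp [*]

/-- Permutes the columns, and then the symbols in each column. -/
def relabel (τ : Equiv.Perm (Fin 5)) (σ : Fin 5 → Equiv.Perm (Fin 3)) (r : Word) : Word :=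
  fun i => σ i (r (τ i))

theorem numZeros_relabel (τ : Equiv.Perm (Fin 5)) {σ : Fin 5 → Equiv.Perm (Fin 3)}
    (hσ : ∀ i, σ i 0 = 0) (r : Word) : (r.relabel τ σ).numZeros = r.numZeros := by
  refine Finset.card_equiv τ fun i => ?_
  rw [Finset.mem_filter, Finset.mem_filter]
  simp only [Finset.mem_univ, true_and, relabel]
  rw [← (σ i).injective.eq_iff (a := r (τ i)), hσ]

/-- The word of `k` zeros followed by ones. -/
def stair (k : ℕ) : Word := fun i => if (i : ℕ) < k then 0 else 1

theorem exists_relabel_eq_stair (r : Word) : ∃ (τ : Equiv.Perm (Fin 5))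
    (σ : Fin 5 → Equiv.Perm (Fin 3)), (∀ i, σ i 0 = 0) ∧ r.relabel τ σ = stair r.numZeros := by
  have hk : r.numZeros ≤ 5 := (Finset.card_le_univ _).trans_eq (Fintype.card_fin 5)
  have hcard : Fintype.card {i : Fin 5 // (i : ℕ) < r.numZeros} =
      Fintype.card {i : Fin 5 // r i = 0} := by
    rw [Fintype.card_subtype, Fintype.card_subtype]
    change _ = r.numZeros
    generalize r.numZeros = k at hk
    decide +revert
  obtain ⟨e⟩ := Fintype.card_eq.1 hcard
  have hτ (i : Fin 5) : r (e.extendSubtype i) = 0 ↔ (i : ℕ) < r.numZeros := by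
    by_cases h : (i : ℕ) < r.numZeros
    · exact iff_of_true (e.extendSubtype_mem i h) h
    · exact iff_of_false (e.extendSubtype_not_mem i h) h
  refine ⟨e.extendSubtype, fun i => if r (e.extendSubtype i) = 2 then Equiv.swap 1 2 else 1,
    fun i => by dsimp only; split_ifs <;> decide, funext fun i => ?_⟩
  have h := hτ i
  simp only [relabel, stair, ← h]
  generalize r (e.extendSubtype i) = v
  revert v
  decide

end Word

namespace IsTight

variable {C : Finset Word}

theorem image (hC : IsTight C) (τ : Equiv.Perm (Fin 5)) {σ : Fin 5 → Equiv.Perm (Fin 3)}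
    (hσ : ∀ i, σ i 0 = 0) : IsTight (C.image (Word.relabel τ σ)) where
  covers a b c hab hac hbc w := by
    obtain ⟨r, hr, h1, h2, h3⟩ := hC.covers (τ a) (τ b) (τ c) (τ.injective.ne hab)
      (τ.injective.ne hac) (τ.injective.ne hbc) fun j => (σ (τ.symm j)).symm (w (τ.symm j))
    rw [Equiv.symm_apply_apply] at h1 h2 h3
    exact ⟨_, Finset.mem_image_of_mem _ hr, by simp [Word.relabel, h1], by simp [Word.relabel, h2],
      by simp [Word.relabel, h3]⟩
  card_le a := by
    rw [Finset.filter_image]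
    refine Finset.card_image_le.trans (le_trans (Finset.card_le_card fun r hr => ?_)
      (hC.card_le (τ a)))
    rw [Finset.mem_filter] at hr ⊢
    refine ⟨hr.1, (σ a).injective ?_⟩
    rw [hσ]
    exact hr.2

/-- Ten words show the nine pairs of symbols in two further columns, so they have at most one pair
of words in common that shows the same symbols. -/
theorem eq_or_eq_of_collide (hC : IsTight C) {i b c : Fin 5} (hib : i ≠ b) (hic : i ≠ c)
    (hbc : b ≠ c) {u v w z : Word} (hu : u ∈ C) (hv : v ∈ C) (hw : w ∈ C) (hz : z ∈ C)
    (huv : u ≠ v) (hwz : w ≠ z) (hui : u i = 0) (hvi : v i = 0) (hwi : w i = 0) (hzi : z i = 0)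
    (hb : u b = v b) (hc : u c = v c) (hb' : w b = z b) (hc' : w c = z c) : w = u ∨ w = v := by
  by_contra! hne
  have hsub : (Finset.univ : Finset (Fin 3 × Fin 3)) ⊆
      (((C.filter fun r => r i = 0).erase u).erase w).image fun r => (r b, r c) := by
    rintro ⟨p, q⟩ -
    rw [Finset.mem_image]
    obtain ⟨r, hr, h1, h2, h3⟩ := hC.covers i b c hib hic hbc
      fun j => if j = i then 0 else if j = b then p else q
    simp only [if_true, hib.symm, hic.symm, hbc.symm, if_false] at h1 h2 h3
    by_cases hrw : r = u ∨ r = w ∧ z = u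
    · -- `u`, and hence also `w` if it collides with `u`, shows the same symbols as `v`.
      have hvr : v b = p ∧ v c = q := by
        obtain rfl | ⟨rfl, rfl⟩ := hrw
        · exact ⟨hb ▸ h2, hc ▸ h3⟩
        · exact ⟨by rw [← hb, ← hb', h2], by rw [← hc, ← hc', h3]⟩
      exact ⟨v, by simp [hne.2.symm, huv.symm, hv, hvi], by simp [hvr]⟩
    · rw [not_or, not_and] at hrw
      by_cases hr' : r = w
      · subst hr'
        exact ⟨z, by simp [hwz.symm, hrw.2 rfl, hz, hzi], by simp [← hb', ← hc', h2, h3]⟩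
      · exact ⟨r, by simp [hr', hrw.1, hr, h1], by simp [h2, h3]⟩
  have h1 := (Finset.card_le_card hsub).trans Finset.card_image_le
  have hmu : u ∈ C.filter fun r => r i = 0 := by simp [hu, hui]
  have hmw : w ∈ (C.filter fun r => r i = 0).erase u := by simp [hne.1, hw, hwi]
  have h2 := Finset.card_erase_of_mem hmw
  have h3 := Finset.card_erase_of_mem hmu
  have h4 := hC.card_le i
  have h5 : (Finset.univ : Finset (Fin 3 × Fin 3)).card = 9 := by decide
  omega

theorem isTightCode (hC : IsTight C) : TightSearch.IsTightCode (Word.code '' C) where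
  lt := by
    rintro _ ⟨r, -, rfl⟩
    exact r.code_lt
  covers a b c hab hbc hc y hy := by
    obtain ⟨w, rfl⟩ := Word.exists_code_eq hy
    lift c to Fin 5 using hc
    lift b to Fin 5 using hbc.trans c.2
    lift a to Fin 5 using hab.trans b.2
    obtain ⟨r, hr, h⟩ := hC.covers a b c (Fin.ne_of_lt hab) (Fin.ne_of_lt (hab.trans hbc))
      (Fin.ne_of_lt hbc) w
    refine ⟨_, ⟨r, hr, rfl⟩, ?_⟩
    simpa only [TightSearch.Agree, Word.digit_code, Fin.val_inj] using h
  collide a b c hab hbc hc i hi := by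
    rintro _ ⟨u, hu, rfl⟩ _ ⟨v, hv, rfl⟩ _ ⟨w, hw, rfl⟩ _ ⟨z, hz, rfl⟩ huv hwz hui hwi h h'
    lift c to Fin 5 using hc
    lift b to Fin 5 using hbc.trans c.2
    lift a to Fin 5 using hab.trans b.2
    have hab' : a ≠ b := Fin.ne_of_lt hab
    have hac' : a ≠ c := Fin.ne_of_lt (hab.trans hbc)
    have hbc' : b ≠ c := Fin.ne_of_lt hbc
    have hz0 (r : Word) (j : Fin 5) : TightSearch.digit r.code j = 0 ↔ r j = 0 := by
      rw [Word.digit_code, Fin.ext_iff]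
      rfl
    simp only [TightSearch.Agree, Word.digit_code, Fin.val_inj] at h h'
    rw [Word.code_injective.ne_iff] at huv hwz
    rw [Word.code_injective.eq_iff, Word.code_injective.eq_iff]
    obtain ⟨ha, hb, hc⟩ := h
    obtain ⟨ha', hb', hc'⟩ := h'
    obtain rfl | rfl | rfl := hi
    · rw [hz0] at hui hwi
      exact hC.eq_or_eq_of_collide hab' hac' hbc' hu hv hw hz huv hwz hui (ha ▸ hui) hwi
        (ha' ▸ hwi) hb hc hb' hc'
    · rw [hz0] at hui hwi
      exact hC.eq_or_eq_of_collide hab'.symm hbc' hac' hu hv hw hz huv hwz hui (hb ▸ hui) hwi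
        (hb' ▸ hwi) ha hc ha' hc'
    · rw [hz0] at hui hwi
      exact hC.eq_or_eq_of_collide hac'.symm hbc'.symm hab' hu hv hw hz huv hwz hui (hc ▸ hui) hwi
        (hc' ▸ hwi) ha hb ha' hb'

theorem false_of_refutes (hC : IsTight C) {ws : List Word} {k : ℕ} (hws : ∀ r ∈ ws, r ∈ C)
    (hnd : ws.Nodup) (hk : ∀ r ∈ C, r ∉ ws → r.numZeros ≤ k)
    (h : TightSearch.refutes (ws.map Word.code) k = true) : False := by
  refine TightSearch.not_refutes hC.isTightCode ?_ (hnd.map Word.code_injective) ?_ h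
  · intro x hx
    obtain ⟨r, hr, rfl⟩ := List.mem_map.1 hx
    exact ⟨r, hws r hr, rfl⟩
  · rintro _ ⟨r, hr, rfl⟩ hn
    rw [Word.zeros_code]
    exact hk r hr fun h => hn (List.mem_map_of_mem h)

end IsTight

/-! ### There are no tight arrays -/

/-! The codes `0`, `81`, `162`, `27`, `108` and `117` belong to the words `00000`, `00001`, `00002`,
`00010`, `00011` and `00111`. -/

theorem refutes_zero_four : TightSearch.refutes [0, 81] 4 = true := by decide +kernel
theorem refutes_zero_three : TightSearch.refutes [0, 108] 3 = true := by decide +kernel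
theorem refutes_zero_two : TightSearch.refutes [0, 117] 2 = true := by decide +kernel
theorem refutes_four_same : TightSearch.refutes [81, 162] 4 = true := by decide +kernel
theorem refutes_four_other : TightSearch.refutes [81, 27] 4 = true := by decide +kernel
theorem refutes_four : TightSearch.refutes [81] 3 = true := by decide +kernel
theorem refutes_three : TightSearch.refutes [108] 3 = true := by decide +kernel

namespace Word

theorem eq_of_numZeros_eq_five : ∀ r : Word, r.numZeros = 5 → r = stair 5 := by decide +kernel

theorem eq_or_eq_of_numZeros_eq_four :
    ∀ r : Word, r.numZeros = 4 → r 4 ≠ 0 → r = stair 4 ∨ r = ![0, 0, 0, 0, 2] := by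
  decide +kernel

/-- A word with four zeros one of which is the last symbol can be moved to `00010` without moving
`00001`. -/
theorem exists_relabel_eq : ∀ r : Word, r.numZeros = 4 → r 4 = 0 → ∃ p : Fin 5,
    (stair 4).relabel (Equiv.swap p 3)
      (fun i => if i = 3 ∧ r p = 2 then Equiv.swap 1 2 else 1) = stair 4 ∧
    r.relabel (Equiv.swap p 3)
      (fun i => if i = 3 ∧ r p = 2 then Equiv.swap 1 2 else 1) = ![0, 0, 0, 1, 0] := by
  decide +kernel

end Word

namespace IsTight

variable {C : Finset Word}

open Word

/-- Without `00000`, a tight array does not contain `00001`: a second word with four zeros would be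
`00002` or, after a relabelling, `00010`. -/
theorem stair_four_notMem (hC : IsTight C) (hmax : ∀ r ∈ C, r.numZeros ≤ 4) : stair 4 ∉ C := by
  intro h4
  by_cases h2 : ![0, 0, 0, 0, 2] ∈ C
  · exact hC.false_of_refutes (ws := [stair 4, ![0, 0, 0, 0, 2]]) (by simp [h4, h2]) (by decide)
      (fun r hr _ => hmax r hr) refutes_four_same
  by_cases hr : ∃ r ∈ C, r ≠ stair 4 ∧ r.numZeros = 4
  · obtain ⟨r, hr, hne, hrz⟩ := hr
    have hr4 : r 4 = 0 := by
      by_contra h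
      obtain rfl | rfl := eq_or_eq_of_numZeros_eq_four r hrz h
      exacts [hne rfl, h2 hr]
    obtain ⟨p, hp, hp'⟩ := exists_relabel_eq r hrz hr4
    have hσ : ∀ i : Fin 5, (if i = 3 ∧ r p = 2 then Equiv.swap 1 2 else 1 : Equiv.Perm (Fin 3)) 0
        = 0 := fun i => by split_ifs <;> decide
    refine (hC.image (Equiv.swap p 3) hσ).false_of_refutes (ws := [stair 4, ![0, 0, 0, 1, 0]]) ?_
      (by decide) ?_ refutes_four_other
    · simp only [List.mem_cons, List.not_mem_nil, or_false, forall_eq_or_imp, forall_eq]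
      exact ⟨Finset.mem_image.2 ⟨_, h4, hp⟩, Finset.mem_image.2 ⟨_, hr, hp'⟩⟩
    · intro s hs _
      obtain ⟨s', hs', rfl⟩ := Finset.mem_image.1 hs
      rw [numZeros_relabel _ hσ]
      exact hmax s' hs'
  · refine hC.false_of_refutes (ws := [stair 4]) (by simp [h4]) (by decide) (fun r hr' hn => ?_)
      refutes_four
    have := hmax r hr'
    by_contra hlt
    exact hr ⟨r, hr', by simpa using hn, by omega⟩

/-- A tight array does not contain the word of `k` zeros followed by ones, if it has no nonzero word
with more zeros. -/
theorem stair_notMem (hC : IsTight C) {k : ℕ} (h2 : 2 ≤ k) (h4 : k ≤ 4)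
    (hmax : ∀ r ∈ C, r ≠ stair 5 → r.numZeros ≤ k) : stair k ∉ C := by
  intro hk
  by_cases h5 : stair 5 ∈ C
  · have hmem : ∀ r ∈ [stair 5, stair k], r ∈ C := by simp [h5, hk]
    have hmax' : ∀ r ∈ C, r ∉ [stair 5, stair k] → r.numZeros ≤ k := fun r hr hn =>
      hmax r hr fun h => hn (h ▸ List.mem_cons_self)
    interval_cases k
    · exact hC.false_of_refutes hmem (by decide) hmax' refutes_zero_two
    · exact hC.false_of_refutes hmem (by decide) hmax' refutes_zero_three
    · exact hC.false_of_refutes hmem (by decide) hmax' refutes_zero_four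
  · have hmax' : ∀ r ∈ C, r.numZeros ≤ k := fun r hr => hmax r hr fun h => h5 (h ▸ hr)
    interval_cases k
    · -- A word that is zero in the first three columns has more than two zeros.
      obtain ⟨r, hr, hr0, hr1, hr2⟩ :=
        hC.covers 0 1 2 (by decide) (by decide) (by decide) (stair 5)
      have hsub : ({0, 1, 2} : Finset (Fin 5)) ⊆ Finset.univ.filter fun i => r i = 0 := by
        simp [Finset.insert_subset_iff, hr0, hr1, hr2, stair]
      exact absurd ((Finset.card_le_card hsub).trans (hmax' r hr)) (by decide)
    · exact hC.false_of_refutes (ws := [stair 3]) (by simp [hk]) (by decide)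
        (fun r hr _ => hmax' r hr) refutes_three
    · exact hC.stair_four_notMem hmax' hk

/-- There are no tight arrays. -/
protected theorem false (hC : IsTight C) : False := by
  obtain ⟨w, hw, hw0, hw1, hw2⟩ :=
    hC.covers 0 1 2 (by decide) (by decide) (by decide) (stair 2)
  have hsub : ({0, 1} : Finset (Fin 5)) ⊆ Finset.univ.filter fun i => w i = 0 := by
    simp [Finset.insert_subset_iff, hw0, hw1, stair]
  have hwne : w ≠ stair 5 := by
    rintro rfl
    exact absurd hw2 (by decide)
  -- The search starts from a nonzero word with as many zeros as possible.
  obtain ⟨r, hr, hmax⟩ := Finset.exists_max_image (C.erase (stair 5)) numZeros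
    ⟨w, Finset.mem_erase.2 ⟨hwne, hw⟩⟩
  rw [Finset.mem_erase] at hr
  have h2 : 2 ≤ r.numZeros :=
    (Finset.card_le_card hsub).trans (hmax w (Finset.mem_erase.2 ⟨hwne, hw⟩))
  have h5 : r.numZeros ≤ 5 := (Finset.card_le_univ _).trans_eq (Fintype.card_fin 5)
  have h5' : r.numZeros ≠ 5 := fun h => hr.1 (eq_of_numZeros_eq_five r h)
  obtain ⟨τ, σ, hσ, h⟩ := exists_relabel_eq_stair r
  refine (hC.image τ hσ).stair_notMem h2 (by omega) ?_ (Finset.mem_image.2 ⟨r, hr.2, h⟩)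
  intro s hs hs5
  obtain ⟨s', hs', rfl⟩ := Finset.mem_image.1 hs
  rw [numZeros_relabel _ hσ]
  refine hmax s' (Finset.mem_erase.2 ⟨?_, hs'⟩)
  rintro rfl
  exact hs5 (funext fun i => by simp [relabel, stair, hσ])

end IsTight

/-! ### Covering arrays of Pauli settings -/

/-- The settings in `S` cover every assignment of Pauli operators to `k` qubits: `S` is a covering
array of strength `k`. -/
def Covers (k n : ℕ) (S : Finset (PauliSetting n)) : Prop :=
  ∀ T : Finset (Fin n), T.card = k → ∀ p : PauliSetting n, ∃ s ∈ S, ∀ i ∈ T, s i = p i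

theorem Covers.image_castSucc {k n : ℕ} {S : Finset (PauliSetting (n + 1))}
    (hS : Covers k (n + 1) S) : Covers k n (S.image fun s i => s i.castSucc) := by
  intro T hT p
  obtain ⟨s, hs, h⟩ := hS (T.map Fin.castSuccEmb) (by simpa using hT)
    (Fin.snoc (α := fun _ => Pauli) p .X)
  refine ⟨_, Finset.mem_image_of_mem _ hs, fun i hi => ?_⟩
  simpa using h i.castSucc (Finset.mem_map_of_mem Fin.castSuccEmb hi)

theorem exists_card_filter_le {S : Finset (PauliSetting 5)} (hS : S.card ≤ 32) (i : Fin 5) :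
    ∃ m : Pauli, (S.filter fun s => s i = m).card ≤ 10 := by
  obtain ⟨m, -, hm⟩ := Finset.exists_card_fiber_lt_of_card_lt_mul (s := S) (t := Finset.univ)
    (f := fun s => s i) (n := 11) (Nat.lt_succ_of_le hS)
  exact ⟨m, Nat.le_of_lt_succ hm⟩

theorem exists_equiv_eq_zero : ∀ m : Pauli, ∃ σ : Pauli ≃ Fin 3, σ m = 0 := by
  intro m
  have e : Pauli ≃ Fin 3 := Fintype.equivFinOfCardEq rfl
  exact ⟨e.trans (Equiv.swap (e m) 0), by simp⟩

theorem Covers.le_card_five {S : Finset (PauliSetting 5)} (hS : Covers 3 5 S) : 33 ≤ S.card := by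
  by_contra! hlt
  choose m hm using fun i => exists_card_filter_le (Nat.le_of_lt_succ hlt) i
  choose σ hσ using fun i => exists_equiv_eq_zero (m i)
  refine IsTight.false (C := S.image fun s i => σ i (s i)) ⟨?_, ?_⟩
  · intro a b c hab hac hbc w
    obtain ⟨s, hs, h⟩ := hS {a, b, c} (Finset.card_eq_three.2 ⟨a, b, c, hab, hac, hbc, rfl⟩)
      fun i => (σ i).symm (w i)
    refine ⟨_, Finset.mem_image_of_mem _ hs, ?_, ?_, ?_⟩
    all_goals rw [h _ (by simp), Equiv.apply_symm_apply]
  · intro a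
    rw [Finset.filter_image]
    refine Finset.card_image_le.trans ((Finset.card_le_card fun s hs => ?_).trans (hm a))
    rw [Finset.mem_filter] at hs ⊢
    exact ⟨hs.1, (σ a).injective (hs.2.trans (hσ a).symm)⟩

theorem Covers.le_card_six {S : Finset (PauliSetting 6)} (hS : Covers 3 6 S) : 33 ≤ S.card :=
  hS.image_castSucc.le_card_five.trans Finset.card_image_le

/-- The starter words of an array of strength three: the constant word and five words that show, on
any three columns, each of the patterns `aab`, `aba`, `abb` and `abc`. -/
def starters : Finset (Fin 6 → Fin 3) :=
  {![0, 0, 0, 0, 0, 0], ![0, 1, 2, 0, 1, 2], ![0, 1, 0, 1, 2, 2], ![0, 1, 1, 2, 2, 0],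
    ![0, 0, 1, 2, 1, 2], ![0, 1, 2, 2, 0, 1]}

/-- All the settings that arise from the starter words by reading the symbols as distinct Pauli
operators. -/
def starterSettings : Finset (PauliSetting 6) :=
  (Finset.univ ×ˢ starters : Finset ((Fin 3 ≃ Pauli) × (Fin 6 → Fin 3))).image fun x => x.1 ∘ x.2

theorem card_starterSettings : starterSettings.card = 33 := by decide +kernel

theorem card_image_starterSettings :
    (starterSettings.image fun s (i : Fin 5) => s i.castSucc).card = 33 := by decide +kernel

theorem exists_mem_starters : ∀ a b c : Fin 6, a ≠ b → a ≠ c → b ≠ c → ∀ x y z : Pauli,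
    ∃ w ∈ starters, (x = y ↔ w a = w b) ∧ (x = z ↔ w a = w c) ∧ (y = z ↔ w b = w c) := by
  decide +kernel

theorem exists_equiv : ∀ (x y z : Pauli) (u v w : Fin 3), (x = y ↔ u = v) → (x = z ↔ u = w) →
    (y = z ↔ v = w) → ∃ e : Fin 3 ≃ Pauli, e u = x ∧ e v = y ∧ e w = z := by
  decide +kernel

theorem covers_starterSettings : Covers 3 6 starterSettings := by
  intro T hT p
  obtain ⟨a, b, c, hab, hac, hbc, rfl⟩ := Finset.card_eq_three.1 hT
  obtain ⟨w, hw, h1, h2, h3⟩ := exists_mem_starters a b c hab hac hbc (p a) (p b) (p c)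
  obtain ⟨e, ha, hb, hc⟩ := exists_equiv _ _ _ _ _ _ h1 h2 h3
  refine ⟨e ∘ w, Finset.mem_image.2 ⟨(e, w), by simp [hw], rfl⟩, ?_⟩
  simp [ha, hb, hc]

theorem isLeast_card_covers_six : IsLeast {m | ∃ S, S.card = m ∧ Covers 3 6 S} 33 :=
  ⟨⟨_, card_starterSettings, covers_starterSettings⟩, by
    rintro _ ⟨S, rfl, hS⟩
    exact hS.le_card_six⟩

theorem isLeast_card_covers_five : IsLeast {m | ∃ S, S.card = m ∧ Covers 3 5 S} 33 :=
  ⟨⟨_, card_image_starterSettings, covers_starterSettings.image_castSucc⟩, by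
    rintro _ ⟨S, rfl, hS⟩
    exact hS.le_card_five⟩

/-! ### The binary program -/

theorem mem_settingClique {n : ℕ} {s : PauliSetting n} {v : Fin n × Pauli} :
    v ∈ settingClique s ↔ s v.1 = v.2 := by
  simp only [settingClique, Finset.mem_image, Finset.mem_univ, true_and, Prod.ext_iff]
  exact ⟨by rintro ⟨i, rfl, h⟩; exact h, fun h => ⟨_, rfl, h⟩⟩

theorem covers_iff_forall_isHyperedge {k n : ℕ} {S : Finset (PauliSetting n)} :
    Covers k n S ↔ ∀ e, IsHyperedge k n e → ∃ s ∈ S, e ⊆ settingClique s := by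
  constructor
  · rintro hS e ⟨hcard, hinj⟩
    have hp : ∀ i : Fin n, ∃ p : Pauli, ∀ q, (i, q) ∈ e → p = q := fun i => by
      by_cases h : ∃ p, (i, p) ∈ e
      · obtain ⟨p, hp⟩ := h
        exact ⟨p, fun q hq => congrArg Prod.snd (hinj hp hq rfl)⟩
      · exact ⟨.X, fun q hq => (h ⟨q, hq⟩).elim⟩
    choose p hp using hp
    obtain ⟨s, hs, h⟩ := hS (e.image Prod.fst) (by rw [Finset.card_image_of_injOn hinj, hcard]) p
    refine ⟨s, hs, fun v hv => mem_settingClique.2 ?_⟩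
    rw [h _ (Finset.mem_image_of_mem _ hv), hp _ _ hv]
  · intro hS T hT p
    obtain ⟨s, hs, h⟩ := hS (T.image fun i => (i, p i))
      ⟨by rw [Finset.card_image_of_injective _ fun _ _ h => congrArg Prod.fst h, hT], by
        rintro _ hv _ hw hvw
        obtain ⟨i, -, rfl⟩ := Finset.mem_image.1 hv
        obtain ⟨j, -, rfl⟩ := Finset.mem_image.1 hw
        obtain rfl : i = j := hvw
        rfl⟩
    exact ⟨s, hs, fun i hi => mem_settingClique.1 (h (Finset.mem_image_of_mem _ hi))⟩

theorem isFeasible_indicator_iff {k n : ℕ} {S : Finset (PauliSetting n)} :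
    IsFeasible k n (fun c => if c ∈ S then 1 else 0) ↔ Covers k n S := by
  simp only [IsFeasible, covers_iff_forall_isHyperedge, Nat.one_le_iff_ne_zero, ne_eq,
    Finset.sum_eq_zero_iff, Finset.mem_univ, true_imp_iff, not_forall, mul_eq_zero, ite_eq_right_iff,
    one_ne_zero, imp_false, not_or, not_not]
  exact ⟨fun h => h.2, fun h => ⟨fun c => by by_cases hc : c ∈ S <;> simp [hc], h⟩⟩

theorem binaryProgramValues_eq (k n : ℕ) :
    binaryProgramValues k n = {m | ∃ S : Finset (PauliSetting n), S.card = m ∧ Covers k n S} := by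
  ext m
  constructor
  · rintro ⟨z, hz, rfl⟩
    have hz' : z = fun c => if c ∈ Finset.univ.filter (z · = 1) then 1 else 0 := by
      funext c
      rcases hz.1 c with h | h <;> simp [h]
    refine ⟨Finset.univ.filter (z · = 1), ?_, isFeasible_indicator_iff.1 (hz' ▸ hz)⟩
    conv_rhs => rw [hz']
    rw [Finset.sum_boole, Finset.filter_mem_eq_inter, Finset.univ_inter, Nat.cast_id]
  · rintro ⟨S, rfl, hS⟩
    exact ⟨_, isFeasible_indicator_iff.2 hS, by simp⟩

/-! ### Tensor products of single-qubit operators -/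

section TensorOperator

variable {n : ℕ}

theorem tensorOperator_one : tensorOperator (1 : Fin n → Matrix (Fin 2) (Fin 2) ℂ) = 1 := by
  ext x y
  simp only [tensorOperator, Matrix.of_apply, Pi.one_apply, Matrix.one_apply, funext_iff,
    Finset.prod_boole, Finset.mem_univ, true_imp_iff]

theorem tensorOperator_mul (A B : Fin n → Matrix (Fin 2) (Fin 2) ℂ) :
    tensorOperator A * tensorOperator B = tensorOperator (A * B) := by
  ext x y
  simp only [tensorOperator, Matrix.mul_apply, Matrix.of_apply, Pi.mul_apply,
    Finset.prod_univ_sum, Fintype.piFinset_univ, Finset.prod_mul_distrib]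

theorem trace_tensorOperator (A : Fin n → Matrix (Fin 2) (Fin 2) ℂ) :
    (tensorOperator A).trace = ∏ i, (A i).trace := by
  simp only [tensorOperator, Matrix.trace, Matrix.diag_apply, Matrix.of_apply,
    Finset.prod_univ_sum, Fintype.piFinset_univ]

theorem conjTranspose_tensorOperator (A : Fin n → Matrix (Fin 2) (Fin 2) ℂ) :
    (tensorOperator A).conjTranspose = tensorOperator fun i => (A i).conjTranspose := by
  ext x y
  simp [tensorOperator, Matrix.conjTranspose_apply]

theorem tensorOperator_sum_smul {ι : Type*} [Fintype ι] (c : Fin n → ι → ℂ)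
    (B : Fin n → ι → Matrix (Fin 2) (Fin 2) ℂ) :
    tensorOperator (fun i => ∑ j, c i j • B i j) =
      ∑ f : Fin n → ι, (∏ i, c i (f i)) • tensorOperator fun i => B i (f i) := by
  ext x y
  simp only [tensorOperator, Matrix.of_apply, Matrix.sum_apply, Matrix.smul_apply, smul_eq_mul,
    Finset.prod_univ_sum, Fintype.piFinset_univ, Finset.prod_mul_distrib]

/-- The operator that acts by `A` on the qubits in `T` and trivially on the others. -/
def localOperator (T : Finset (Fin n)) (A : Fin n → Matrix (Fin 2) (Fin 2) ℂ) : QubitOperator n :=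
  tensorOperator fun i => if i ∈ T then A i else 1

theorem sum_eq_sum_glue (T : Finset (Fin n)) (f : (Fin n → Fin 2) → ℂ) :
    ∑ u, f u = ∑ x : {i // i ∈ T} → Fin 2, ∑ z : {i // i ∉ T} → Fin 2, f (glue T x z) := by
  rw [← (Equiv.piEquivPiSubtypeProd (· ∈ T) fun _ => Fin 2).symm.sum_comp, Fintype.sum_prod_type]
  rfl

/-- The entries of the marginal on `T` are the expectations of the matrix units on `T`. -/
theorem marginal_apply (ρ : QubitOperator n) (T : Finset (Fin n)) (x y : Fin n → Fin 2) :
    marginal ρ T (fun i => x i) (fun i => y i) =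
      (ρ * localOperator T fun i => Matrix.single (y i) (x i) 1).trace := by
  have key : ∀ (x' y' : {i // i ∈ T} → Fin 2) (z z' : {i // i ∉ T} → Fin 2),
      localOperator T (fun i => Matrix.single (y i) (x i) 1) (glue T y' z') (glue T x' z) =
        if z = z' ∧ (fun i : {i // i ∈ T} => y i) = y' ∧ (fun i : {i // i ∈ T} => x i) = x'
          then 1 else 0 := by
    intro x' y' z z'
    simp only [localOperator, tensorOperator, Matrix.of_apply]
    rw [← Fintype.prod_subtype_mul_prod_subtype (· ∈ T)]
    have h1 : ∀ i : {i // i ∈ T}, (if (i : Fin n) ∈ T then Matrix.single (y i) (x i) (1 : ℂ) else 1)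
        (glue T y' z' i) (glue T x' z i) = if y i = y' i ∧ x i = x' i then 1 else 0 := fun i => by
      simp [glue, i.2, Matrix.single_apply]
    have h2 : ∀ i : {i // i ∉ T}, (if (i : Fin n) ∈ T then Matrix.single (y i) (x i) (1 : ℂ) else 1)
        (glue T y' z' i) (glue T x' z i) = if z i = z' i then 1 else 0 := fun i => by
      simp [glue, i.2, Matrix.one_apply, eq_comm]
    simp only [h1, h2, Finset.prod_boole, Finset.mem_univ, true_imp_iff, funext_iff, forall_and,
      ← ite_and, mul_ite, mul_one, mul_zero]
  simp only [Matrix.trace, Matrix.diag_apply, Matrix.mul_apply, sum_eq_sum_glue T, key, marginal,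
    Matrix.of_apply, mul_ite, mul_one, mul_zero, ite_and, Finset.sum_ite_eq, Finset.mem_univ,
    if_true, Finset.sum_ite_irrel, Finset.sum_const_zero]

end TensorOperator

/-! ### Pauli operators -/

namespace Pauli

theorem sum_univ {M : Type*} [AddCommMonoid M] (f : Pauli → M) : ∑ p, f p = f X + (f Y + f Z) := by
  change Finset.sum {X, Y, Z} f = _
  rw [Finset.sum_insert (by decide), Finset.sum_insert (by decide), Finset.sum_singleton]

theorem conjTranspose_toMatrix (p : Pauli) : p.toMatrix.conjTranspose = p.toMatrix := by
  ext i j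
  cases p <;> fin_cases i <;> fin_cases j <;> simp [toMatrix]

theorem toMatrix_mul_self (p : Pauli) : p.toMatrix * p.toMatrix = 1 := by
  ext i j
  cases p <;> fin_cases i <;> fin_cases j <;> simp [toMatrix, Matrix.mul_apply]

theorem trace_toMatrix (p : Pauli) : p.toMatrix.trace = 0 := by
  cases p <;> simp [toMatrix, Matrix.trace]

theorem exists_toMatrix_ne_zero (p : Pauli) : ∃ j, p.toMatrix 0 j ≠ 0 := by
  cases p
  exacts [⟨1, by simp [toMatrix]⟩, ⟨1, by simp [toMatrix]⟩, ⟨0, by simp [toMatrix]⟩]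

theorem trace_toMatrix_mul_projector {p q : Pauli} (h : p ≠ q) (b : Fin 2) :
    (p.toMatrix * q.projector b).trace = 0 := by
  have hpq : (p.toMatrix * q.toMatrix).trace = 0 := by
    cases p <;> cases q <;> first | exact (h rfl).elim | simp [toMatrix, Matrix.trace]
  simp [projector, mul_add, hpq, trace_toMatrix]

theorem sum_projector (p : Pauli) : ∑ b, p.projector b = 1 := by
  ext i j
  cases p <;> fin_cases i <;> fin_cases j <;> simp [projector, toMatrix] <;> norm_num

/-- The eigenprojectors of the Pauli operators span the single-qubit operators. -/
theorem exists_eq_sum_projector (A : Matrix (Fin 2) (Fin 2) ℂ) :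
    ∃ c : Pauli × Fin 2 → ℂ, A = ∑ j, c j • j.1.projector j.2 := by
  -- the coefficients of the Pauli matrices in `A`, with that of `1` assigned to the basis of `Z`
  refine ⟨fun j => match j with
    | (.X, b) => (-1) ^ (b : ℕ) * ((A 0 1 + A 1 0) / 2)
    | (.Y, b) => (-1) ^ (b : ℕ) * (Complex.I * (A 0 1 - A 1 0) / 2)
    | (.Z, b) => (A 0 0 + A 1 1) / 2 + (-1) ^ (b : ℕ) * ((A 0 0 - A 1 1) / 2), ?_⟩
  have hI := Complex.I_mul_I
  ext i j
  fin_cases i <;> fin_cases j <;>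
    simp [Fintype.sum_prod_type, sum_univ, projector, toMatrix] <;> grind

end Pauli

/-! ### Reconstruction of marginals and covering arrays -/

section Reconstruction

variable {k n : ℕ} {S : Finset (PauliSetting n)}

theorem Covers.reconstructsMarginals (hS : Covers k n S) : ReconstructsMarginals k n S := by
  intro ρ σ _ _ hprob T hT
  -- Expectations of products of eigenprojectors on `T` are sums of outcome probabilities.
  have h1 : ∀ (p : PauliSetting n) (b : Fin n → Fin 2),
      (ρ * localOperator T fun i => (p i).projector (b i)).trace =
        (σ * localOperator T fun i => (p i).projector (b i)).trace := by
    intro p b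
    obtain ⟨s, hs, h⟩ := hS T hT p
    have hloc : localOperator T (fun i => (p i).projector (b i)) = tensorOperator fun i =>
        ∑ j, (if i ∈ T then if j = b i then 1 else 0 else 1 : ℂ) • (s i).projector j := by
      unfold localOperator
      congr 1
      funext i
      split_ifs with hi
      · simp [h i hi]
      · simp only [one_smul, Pauli.sum_projector]
    rw [hloc, tensorOperator_sum_smul]
    simp only [Finset.mul_sum, Matrix.mul_smul, Matrix.trace_sum, Matrix.trace_smul]
    exact Finset.sum_congr rfl fun a _ => congrArg _ (hprob s hs a)
  -- By multilinearity the same holds for all products of operators on `T`.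
  have h2 : ∀ A : Fin n → Matrix (Fin 2) (Fin 2) ℂ,
      (ρ * localOperator T A).trace = (σ * localOperator T A).trace := by
    intro A
    choose c hc using fun i => Pauli.exists_eq_sum_projector (A i)
    have hloc : localOperator T A = tensorOperator fun i =>
        ∑ j : Pauli × Fin 2, (if i ∈ T then c i j else if j = (.X, 0) then 1 else 0) •
          (if i ∈ T then j.1.projector j.2 else 1) := by
      unfold localOperator
      congr 1
      funext i
      split_ifs with hi
      · exact hc i
      · simp
    rw [hloc, tensorOperator_sum_smul]
    simp only [Finset.mul_sum, Matrix.mul_smul, Matrix.trace_sum, Matrix.trace_smul]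
    exact Finset.sum_congr rfl fun f _ => congrArg _ (h1 (fun i => (f i).1) fun i => (f i).2)
  ext x y
  obtain ⟨x, rfl⟩ : ∃ u : Fin n → Fin 2, (fun i : {i // i ∈ T} => u i) = x :=
    ⟨glue T x 0, funext fun i => by simp [glue]⟩
  obtain ⟨y, rfl⟩ : ∃ u : Fin n → Fin 2, (fun i : {i // i ∈ T} => u i) = y :=
    ⟨glue T y 0, funext fun i => by simp [glue]⟩
  rw [marginal_apply, marginal_apply, h2]

theorem isState_one : IsState ((1 / 2 ^ n : ℂ) • (1 : QubitOperator n)) := by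
  refine ⟨Matrix.PosSemidef.one.smul (by positivity), ?_⟩
  simp [Matrix.trace_smul, Matrix.trace_one]

theorem isState_one_add {P : QubitOperator n} (hP : P.IsHermitian) (hPP : P * P = 1)
    (htr : P.trace = 0) : IsState ((1 / 2 ^ n : ℂ) • (1 + P)) := by
  -- `1 + P` is positive semidefinite, being twice a Hermitian projector.
  have hsq : 1 + P = (1 / 2 : ℂ) • ((1 + P).conjTranspose * (1 + P)) := by
    rw [Matrix.conjTranspose_add, Matrix.conjTranspose_one, hP.eq, mul_add, add_mul, add_mul, hPP,
      mul_one, one_mul, mul_one]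
    module
  refine ⟨Matrix.PosSemidef.smul ?_ (by positivity), ?_⟩
  · rw [hsq]
    exact (Matrix.posSemidef_conjTranspose_mul_self _).smul (by positivity)
  · rw [Matrix.trace_smul, Matrix.trace_add, htr]
    simp [Matrix.trace_one]

/-- If no setting in `S` measures the Pauli operators `p` on the qubits in `T`, the maximally mixed
state and the state with the additional correlation `p` on `T` are not told apart. -/
theorem ReconstructsMarginals.covers (hk : 0 < k) (hS : ReconstructsMarginals k n S) :
    Covers k n S := by
  intro T hT p
  by_contra! h
  set P : QubitOperator n := localOperator T fun i => (p i).toMatrix with hPdef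
  have hherm : P.IsHermitian := by
    rw [Matrix.IsHermitian, hPdef, localOperator, conjTranspose_tensorOperator]
    congr 1
    funext i
    split_ifs
    exacts [Pauli.conjTranspose_toMatrix _, Matrix.conjTranspose_one]
  have hsq : P * P = 1 := by
    rw [hPdef, localOperator, tensorOperator_mul, ← tensorOperator_one]
    congr 1
    funext i
    simp only [Pi.mul_apply, Pi.one_apply]
    split_ifs
    exacts [Pauli.toMatrix_mul_self _, one_mul 1]
  have htr : P.trace = 0 := by
    obtain ⟨i, hi⟩ := Finset.card_pos.1 (hT ▸ hk)
    rw [hPdef, localOperator, trace_tensorOperator]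
    exact Finset.prod_eq_zero (Finset.mem_univ i) (by rw [if_pos hi, Pauli.trace_toMatrix])
  have hprob : ∀ s ∈ S, ∀ a : Fin n → Fin 2, outcomeProb ((1 / 2 ^ n : ℂ) • (1 + P)) s a =
      outcomeProb ((1 / 2 ^ n : ℂ) • 1) s a := by
    intro s hs a
    obtain ⟨i, hi, hne⟩ := h s hs
    have h0 : (P * tensorOperator fun i => (s i).projector (a i)).trace = 0 := by
      rw [hPdef, localOperator, tensorOperator_mul, trace_tensorOperator]
      refine Finset.prod_eq_zero (Finset.mem_univ i) ?_
      rw [Pi.mul_apply, if_pos hi, Pauli.trace_toMatrix_mul_projector hne.symm]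
    simp only [outcomeProb, Matrix.smul_mul, add_mul, Matrix.trace_smul, Matrix.trace_add, h0,
      add_zero]
  have hmarg := hS _ _ (isState_one_add hherm hsq htr) isState_one hprob T hT
  choose y hy using fun i => (p i).exists_toMatrix_ne_zero
  have hentry := congrFun (congrFun hmarg fun i => (0 : Fin n → Fin 2) i) fun i => y i
  rw [marginal_apply, marginal_apply] at hentry
  simp only [Matrix.smul_mul, add_mul, Matrix.trace_smul, Matrix.trace_add, smul_add,
    add_eq_left, smul_eq_zero] at hentry
  refine hentry.elim (by positivity) ?_
  rw [hPdef, localOperator, localOperator, tensorOperator_mul, trace_tensorOperator]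
  refine Finset.prod_ne_zero_iff.2 fun i _ => ?_
  rw [Pi.mul_apply]
  split_ifs
  · simpa [Matrix.trace_mul_single] using hy i
  · simp

theorem pauliSetSizes_eq (hk : 0 < k) :
    pauliSetSizes k n = {m | ∃ S : Finset (PauliSetting n), S.card = m ∧ Covers k n S} := by
  have h : ∀ S : Finset (PauliSetting n), ReconstructsMarginals k n S ↔ Covers k n S := fun S =>
    ⟨fun hS => hS.covers hk, Covers.reconstructsMarginals⟩
  simp only [pauliSetSizes, h]

end Reconstruction

theorem mainTheorem7 :
    (IsLeast (pauliSetSizes 3 5) 33 ∧ IsLeast (pauliSetSizes 3 6) 33) ∧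
      (IsLeast (binaryProgramValues 3 5) 33 ∧ IsLeast (binaryProgramValues 3 6) 33) := by
  rw [pauliSetSizes_eq three_pos, pauliSetSizes_eq three_pos, binaryProgramValues_eq,
    binaryProgramValues_eq]
  exact ⟨⟨isLeast_card_covers_five, isLeast_card_covers_six⟩, isLeast_card_covers_five,
    isLeast_card_covers_six⟩
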